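/- Let $n\ge 1$ be an integer. A Blaschke product of degree $n$ is a rational function $B(z)=\alpha\prod_{k=1}^n\frac{z-a_k}{1-\overline{a_k}z}$ with $\alpha,a_1,\dots,a_n\in\mathbb C$, $|\alpha|=1$ and $|a_k|<1$ for all $k$. Put $M(B)=\sup_{|z|=1}|B'(z)|$ and $m(B)=\inf_{|z|=1}|B'(z)|$. (i) For every Blaschke product $B$ of degree $n$ the numbers $M=M(B)$ and $m=m(B)$ satisfy $$\frac{n}{M-n+1}\le m\le n-1+\frac nM\qquad\text{and}\qquad 0<m\le n\le M.$$ (ii) Conversely, for any real numbers $m,M>0$ such that $n$, $m$, $M$ satisfy these inequalities, there exists a Blaschke product $B$ of degree $n$ with $M(B)=M$ and $m(B)=m$. -/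

import Mathlib

/-- The function `z ↦ α * ∏ k, (z - a k) / (1 - conj (a k) * z)`. -/
noncomputable def blaschkeProduct {n : ℕ} (α : ℂ) (a : Fin n → ℂ) (z : ℂ) : ℂ :=
  α * ∏ k, (z - a k) / (1 - (starRingEnd ℂ) (a k) * z)

/-- `B` is a finite Blaschke product of degree `n`: the constant `α` lies on the unit circle and
the `n` zeros (listed with multiplicity) lie in the open unit disk. -/
def IsBlaschkeProduct (n : ℕ) (B : ℂ → ℂ) : Prop :=
  ∃ (α : ℂ) (a : Fin n → ℂ), ‖α‖ = 1 ∧ (∀ k, ‖a k‖ < 1) ∧ B = blaschkeProduct α a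

/-- `M(B)`, the supremum of `|B'|` on the unit circle. -/
noncomputable def supDeriv (B : ℂ → ℂ) : ℝ :=
  sSup ((fun z : ℂ => ‖deriv B z‖) '' Metric.sphere (0 : ℂ) 1)

/-- `m(B)`, the infimum of `|B'|` on the unit circle. -/
noncomputable def infDeriv (B : ℂ → ℂ) : ℝ :=
  sInf ((fun z : ℂ => ‖deriv B z‖) '' Metric.sphere (0 : ℂ) 1)

/-!
On the unit circle `‖B' z‖` is the sum of the Poisson kernels of the zeros of `B`. If `‖c‖ = 1`, the
equation `z * B z = c` has exactly `n + 1` solutions, all on the unit circle, and Lagrange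
interpolation at them gives `∑ 1 / (1 + ‖B' z‖) = 1`. Choosing `c` so that one solution is a point
where `‖B'‖` is extremal, and estimating the other `n` terms by the opposite extremum, yields the
inequalities between `m(B)` and `M(B)`.

Equality in each of them is attained by Blaschke products built from the orthogonal polynomials for
the weight `‖1 - z‖ ^ (2 * b)`: for these, `‖B'‖ - (n - 1 + b)` is `1 - b` times a square, and
`‖B' 1‖ = n / b`. In between, a connectedness argument applies: by the maximum principle `M(B)`
strictly increases above the value `n` when all zeros are moved radially outwards, so the zero
systems with a given `M(B) > n` form a set homeomorphic to a sphere, on which `m(B)` takes all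
intermediate values.
-/

open Polynomial ComplexConjugate Lagrange Metric

section PoissonKernel

variable {a z : ℂ}

lemma ne_of_norm_lt_one_of_one_le_norm (ha : ‖a‖ < 1) (hz : 1 ≤ ‖z‖) : z ≠ a := by
  rintro rfl
  exact ha.not_ge hz

lemma one_sub_conj_mul_ne_zero (ha : ‖a‖ < 1) (hz : ‖z‖ ≤ 1) : 1 - conj a * z ≠ 0 := by
  rw [sub_ne_zero]
  refine ne_of_apply_ne norm (ne_of_gt ?_)
  rw [norm_one, norm_mul, Complex.norm_conj]
  exact mul_lt_one_of_nonneg_of_lt_one_left (norm_nonneg a) ha hz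

lemma mul_conj_eq_one (hz : ‖z‖ = 1) : z * conj z = 1 := by
  rw [Complex.mul_conj', hz]
  simp

lemma norm_one_sub_conj_mul_sq_sub (a z : ℂ) :
    ‖1 - conj a * z‖ ^ 2 - ‖z - a‖ ^ 2 = (1 - ‖a‖ ^ 2) * (1 - ‖z‖ ^ 2) := by
  rw [← Complex.ofReal_inj]
  push_cast
  simp only [← Complex.mul_conj', map_sub, map_mul, map_one, Complex.conj_conj]
  ring

lemma one_sub_conj_mul_eq (hz : ‖z‖ = 1) : 1 - conj a * z = z * conj (z - a) := by
  rw [map_sub]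
  linear_combination -mul_conj_eq_one hz

lemma norm_one_sub_conj_mul (hz : ‖z‖ = 1) : ‖1 - conj a * z‖ = ‖z - a‖ := by
  rw [one_sub_conj_mul_eq hz, norm_mul, hz, one_mul, Complex.norm_conj]

lemma norm_sub_le_norm_one_sub_conj_mul (ha : ‖a‖ < 1) (hz : ‖z‖ ≤ 1) :
    ‖z - a‖ ≤ ‖1 - conj a * z‖ := by
  refine le_of_sq_le_sq ?_ (norm_nonneg _)
  rw [← sub_nonneg, norm_one_sub_conj_mul_sq_sub]
  exact mul_nonneg (sub_nonneg.2 (pow_le_one₀ (norm_nonneg a) ha.le))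
    (sub_nonneg.2 (pow_le_one₀ (norm_nonneg z) hz))

lemma norm_one_sub_conj_mul_le_norm_sub (ha : ‖a‖ < 1) (hz : 1 ≤ ‖z‖) :
    ‖1 - conj a * z‖ ≤ ‖z - a‖ := by
  refine le_of_sq_le_sq ?_ (norm_nonneg _)
  rw [← sub_nonpos, norm_one_sub_conj_mul_sq_sub]
  exact mul_nonpos_of_nonneg_of_nonpos (sub_nonneg.2 (pow_le_one₀ (norm_nonneg a) ha.le))
    (sub_nonpos.2 (one_le_pow₀ hz))

lemma poissonKernel_zero_eq_re (a z : ℂ) : poissonKernel 0 a z = ((z + a) / (z - a)).re := by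
  simp [poissonKernel_eq_re_herglotzRieszKernel, herglotzRieszKernel_def]

lemma poissonKernel_zero_eq_two_mul_re_sub_one (h : z ≠ a) :
    poissonKernel 0 a z = 2 * (z / (z - a)).re - 1 := by
  have h0 : z - a ≠ 0 := sub_ne_zero.2 h
  have : (z + a) / (z - a) = (2 : ℝ) * (z / (z - a)) - 1 := by
    push_cast
    field_simp
    ring
  rw [poissonKernel_zero_eq_re, this, Complex.sub_re, Complex.re_ofReal_mul, Complex.one_re]

lemma ofReal_poissonKernel_zero (ha : ‖a‖ < 1) (hz : ‖z‖ = 1) :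
    (poissonKernel 0 a z : ℂ) = z * (1 / (z - a) + conj a / (1 - conj a * z)) := by
  have hz0 : z ≠ 0 := norm_ne_zero_iff.1 (hz ▸ one_ne_zero)
  have h1 : z - a ≠ 0 := sub_ne_zero.2 (ne_of_norm_lt_one_of_one_le_norm ha hz.ge)
  have h2 : conj (z - a) ≠ 0 := (_root_.map_ne_zero _).2 h1
  rw [one_sub_conj_mul_eq hz, poissonKernel_def]
  push_cast
  simp only [sub_zero, ← Complex.mul_conj']
  field_simp
  rw [map_sub]
  ring

lemma div_le_poissonKernel_zero (ha : ‖a‖ < 1) (hz : ‖z‖ = 1) :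
    (1 - ‖a‖) / (1 + ‖a‖) ≤ poissonKernel 0 a z := by
  simpa [poissonKernel_zero_eq_re] using
    le_re_herglotzRieszKernel (mem_sphere_zero_iff_norm.2 hz) (mem_ball_zero_iff.2 ha)

lemma poissonKernel_zero_pos (ha : ‖a‖ < 1) (hz : ‖z‖ = 1) : 0 < poissonKernel 0 a z :=
  (div_pos (sub_pos.2 ha) (by positivity)).trans_le (div_le_poissonKernel_zero ha hz)

end PoissonKernel

/-- The sum of the Poisson kernels of the points `a k`. On the unit circle it is the modulus of the
derivative of the Blaschke product with zeros `a k`; allowing an arbitrary finite index type avoids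
carrying the degree around. -/
noncomputable def poissonSum {ι : Type*} [Fintype ι] (a : ι → ℂ) (z : ℂ) : ℝ :=
  ∑ k, poissonKernel 0 (a k) z

/-- The denominator `∏ k, (1 - conj (a k) * X)` of the Blaschke product with zeros `a k`, whose
numerator is `Lagrange.nodal Finset.univ a`. -/
noncomputable def blaschkeDen {ι : Type*} [Fintype ι] (a : ι → ℂ) : ℂ[X] :=
  ∏ k, (1 - C (conj (a k)) * X)

/-- The polynomial whose roots are the solutions of `z * B z = c`, where `B` is the Blaschke product
with zeros `a k` and `α = 1`. -/
noncomputable def fibrePoly {ι : Type*} [Fintype ι] (a : ι → ℂ) (c : ℂ) : ℂ[X] :=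
  X * nodal Finset.univ a - C c * blaschkeDen a

section Fibre

variable {ι : Type*} [Fintype ι] {a : ι → ℂ} {c z : ℂ}

lemma poissonSum_nonneg (ha : ∀ k, ‖a k‖ < 1) (hz : ‖z‖ = 1) : 0 ≤ poissonSum a z :=
  Finset.sum_nonneg fun k _ => (poissonKernel_zero_pos (ha k) hz).le

lemma poissonSum_pos [Nonempty ι] (ha : ∀ k, ‖a k‖ < 1) (hz : ‖z‖ = 1) : 0 < poissonSum a z :=
  Finset.sum_pos (fun k _ => poissonKernel_zero_pos (ha k) hz) Finset.univ_nonempty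

lemma ofReal_poissonSum (ha : ∀ k, ‖a k‖ < 1) (hz : ‖z‖ = 1) :
    (poissonSum a z : ℂ) = z * (∑ k, 1 / (z - a k) + ∑ k, conj (a k) / (1 - conj (a k) * z)) := by
  rw [poissonSum, Complex.ofReal_sum, ← Finset.sum_add_distrib, Finset.mul_sum]
  exact Finset.sum_congr rfl fun k _ => ofReal_poissonKernel_zero (ha k) hz

lemma eval_blaschkeDen (a : ι → ℂ) (z : ℂ) :
    (blaschkeDen a).eval z = ∏ k, (1 - conj (a k) * z) := by
  simp [blaschkeDen, eval_prod]

lemma eval_nodal_ne_zero (ha : ∀ k, ‖a k‖ < 1) (hz : 1 ≤ ‖z‖) :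
    (nodal Finset.univ a).eval z ≠ 0 :=
  eval_nodal_not_at_node fun k _ => ne_of_norm_lt_one_of_one_le_norm (ha k) hz

lemma eval_blaschkeDen_ne_zero (ha : ∀ k, ‖a k‖ < 1) (hz : ‖z‖ ≤ 1) :
    (blaschkeDen a).eval z ≠ 0 := by
  rw [eval_blaschkeDen]
  exact Finset.prod_ne_zero_iff.2 fun k _ => one_sub_conj_mul_ne_zero (ha k) hz

lemma norm_eval_nodal_eq (hz : ‖z‖ = 1) :
    ‖(nodal Finset.univ a).eval z‖ = ‖(blaschkeDen a).eval z‖ := by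
  simp only [eval_nodal, eval_blaschkeDen, norm_prod, norm_one_sub_conj_mul hz]

lemma norm_eval_nodal_le (ha : ∀ k, ‖a k‖ < 1) (hz : ‖z‖ ≤ 1) :
    ‖(nodal Finset.univ a).eval z‖ ≤ ‖(blaschkeDen a).eval z‖ := by
  simp only [eval_nodal, eval_blaschkeDen, norm_prod]
  exact Finset.prod_le_prod (fun _ _ => norm_nonneg _)
    fun k _ => norm_sub_le_norm_one_sub_conj_mul (ha k) hz

lemma norm_eval_blaschkeDen_le (ha : ∀ k, ‖a k‖ < 1) (hz : 1 ≤ ‖z‖) :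
    ‖(blaschkeDen a).eval z‖ ≤ ‖(nodal Finset.univ a).eval z‖ := by
  simp only [eval_nodal, eval_blaschkeDen, norm_prod]
  exact Finset.prod_le_prod (fun _ _ => norm_nonneg _)
    fun k _ => norm_one_sub_conj_mul_le_norm_sub (ha k) hz

lemma eval_derivative_nodal (h : ∀ k, z ≠ a k) :
    (nodal Finset.univ a).derivative.eval z =
      (nodal Finset.univ a).eval z * ∑ k, 1 / (z - a k) := by
  classical
  rw [derivative_nodal, eval_finsetSum, Finset.mul_sum]
  refine Finset.sum_congr rfl fun k hk => ?_
  have : z - a k ≠ 0 := sub_ne_zero.2 (h k)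
  rw [nodal_eq_mul_nodal_erase hk, eval_mul, eval_sub, eval_X, eval_C]
  field_simp

lemma eval_derivative_blaschkeDen (h : ∀ k, 1 - conj (a k) * z ≠ 0) :
    (blaschkeDen a).derivative.eval z =
      -((blaschkeDen a).eval z * ∑ k, conj (a k) / (1 - conj (a k) * z)) := by
  classical
  rw [blaschkeDen, derivative_prod_finset, eval_finsetSum, Finset.mul_sum, ← Finset.sum_neg_distrib]
  refine Finset.sum_congr rfl fun k hk => ?_
  rw [← Finset.mul_prod_erase _ _ hk]
  simp
  field_simp [h k]

lemma poissonSum_eq_two_mul_re_sub_card (h : ∀ k, z ≠ a k) :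
    poissonSum a z =
      2 * (z * (nodal Finset.univ a).derivative.eval z / (nodal Finset.univ a).eval z).re -
        Fintype.card ι := by
  have h0 : (nodal Finset.univ a).eval z ≠ 0 := eval_nodal_not_at_node fun k _ => h k
  rw [eval_derivative_nodal h, mul_left_comm, mul_div_cancel_left₀ _ h0, Finset.mul_sum,
    Complex.re_sum, Finset.mul_sum, poissonSum,
    Finset.sum_congr rfl fun k _ => poissonKernel_zero_eq_two_mul_re_sub_one (h k)]
  simp [Finset.sum_sub_distrib, div_eq_mul_inv]

lemma natDegree_blaschkeDen_le (a : ι → ℂ) : (blaschkeDen a).natDegree ≤ Fintype.card ι := by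
  refine (natDegree_prod_le _ _).trans ?_
  refine (Finset.sum_le_card_nsmul _ _ 1 fun k _ => ?_).trans (by simp)
  compute_degree

lemma natDegree_X_mul_nodal (a : ι → ℂ) :
    (X * nodal Finset.univ a : ℂ[X]).natDegree = Fintype.card ι + 1 := by
  rw [natDegree_X_mul nodal_ne_zero, natDegree_nodal, Finset.card_univ]

lemma natDegree_C_mul_blaschkeDen_lt (a : ι → ℂ) (c : ℂ) :
    (C c * blaschkeDen a).natDegree < (X * nodal Finset.univ a : ℂ[X]).natDegree := by
  rw [natDegree_X_mul_nodal]
  exact Nat.lt_succ_of_le ((natDegree_C_mul_le _ _).trans (natDegree_blaschkeDen_le a))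

lemma natDegree_fibrePoly (a : ι → ℂ) (c : ℂ) :
    (fibrePoly a c).natDegree = Fintype.card ι + 1 := by
  rw [fibrePoly, natDegree_sub_eq_left_of_natDegree_lt (natDegree_C_mul_blaschkeDen_lt a c),
    natDegree_X_mul_nodal]

lemma monic_fibrePoly (a : ι → ℂ) (c : ℂ) : (fibrePoly a c).Monic :=
  (monic_X.mul nodal_monic).sub_of_left
    (degree_lt_degree (natDegree_C_mul_blaschkeDen_lt a c))

lemma isRoot_fibrePoly_iff :
    (fibrePoly a c).IsRoot z ↔
      z * (nodal Finset.univ a).eval z = c * (blaschkeDen a).eval z := by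
  simp [fibrePoly, sub_eq_zero]

lemma norm_eq_one_of_isRoot_fibrePoly (ha : ∀ k, ‖a k‖ < 1) (hc : ‖c‖ = 1)
    (hz : (fibrePoly a c).IsRoot z) : ‖z‖ = 1 := by
  have h := congrArg norm (isRoot_fibrePoly_iff.1 hz)
  rw [norm_mul, norm_mul, hc, one_mul] at h
  rcases lt_trichotomy ‖z‖ 1 with hlt | heq | hgt
  · have h1 := norm_eval_nodal_le ha hlt.le
    have h2 := norm_pos_iff.2 (eval_blaschkeDen_ne_zero ha hlt.le)
    nlinarith [norm_nonneg z]
  · exact heq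
  · have h1 := norm_eval_blaschkeDen_le ha hgt.le
    have h2 := norm_pos_iff.2 (eval_nodal_ne_zero ha hgt.le)
    nlinarith

lemma eval_derivative_fibrePoly (ha : ∀ k, ‖a k‖ < 1) (hc : ‖c‖ = 1)
    (hz : (fibrePoly a c).IsRoot z) :
    (fibrePoly a c).derivative.eval z = (nodal Finset.univ a).eval z * (1 + poissonSum a z) := by
  have hz1 := norm_eq_one_of_isRoot_fibrePoly ha hc hz
  have hN := eval_derivative_nodal fun k => ne_of_norm_lt_one_of_one_le_norm (ha k) hz1.ge
  have hD := eval_derivative_blaschkeDen fun k => one_sub_conj_mul_ne_zero (ha k) hz1.le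
  have hroot := isRoot_fibrePoly_iff.1 hz
  simp only [fibrePoly, derivative_sub, derivative_mul, derivative_X, derivative_C, eval_sub,
    eval_add, eval_mul, eval_X, eval_C, eval_one, eval_zero, ofReal_poissonSum ha hz1, hN, hD]
  linear_combination -hroot * ∑ k, conj (a k) / (1 - conj (a k) * z)

lemma eval_derivative_fibrePoly_ne_zero (ha : ∀ k, ‖a k‖ < 1) (hc : ‖c‖ = 1)
    (hz : (fibrePoly a c).IsRoot z) : (fibrePoly a c).derivative.eval z ≠ 0 := by
  have hz1 := norm_eq_one_of_isRoot_fibrePoly ha hc hz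
  rw [eval_derivative_fibrePoly ha hc hz]
  refine mul_ne_zero (eval_nodal_ne_zero ha hz1.ge) ?_
  exact_mod_cast (add_pos_of_pos_of_nonneg one_pos (poissonSum_nonneg ha hz1)).ne'

lemma nodup_roots_of_eval_derivative_ne_zero {F : Type*} [Field F] {p : F[X]} (hp : p ≠ 0)
    (h : ∀ x, p.IsRoot x → p.derivative.eval x ≠ 0) : p.roots.Nodup := by
  classical
  rw [Multiset.nodup_iff_count_le_one]
  intro x
  rw [count_roots]
  by_contra! hx
  obtain ⟨hx0, hx1⟩ := (one_lt_rootMultiplicity_iff_isRoot hp).1 hx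
  exact h x hx0 hx1

-- Comparison of leading coefficients in the Lagrange interpolation of `q` at the roots of `p`.
lemma sum_roots_eval_div_eval_derivative {F : Type*} [Field F] [DecidableEq F] {p q : F[X]}
    (hp : p.Monic) (hsplit : p.Splits) (hroots : p.roots.Nodup) (hq : q ≠ 0)
    (hdeg : p.natDegree = q.natDegree + 1) :
    ∑ x ∈ p.roots.toFinset, q.eval x / p.derivative.eval x = q.leadingCoeff := by
  have hcard : p.roots.toFinset.card = q.natDegree + 1 := by
    rw [Multiset.toFinset_card_of_nodup hroots, ← hsplit.natDegree_eq_card_roots, hdeg]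
  have hnodal : nodal p.roots.toFinset id = p := by
    conv_rhs => rw [hsplit.eq_prod_roots_of_monic hp]
    rw [nodal_eq, Finset.prod, Multiset.toFinset_val, hroots.dedup]
    rfl
  rw [leadingCoeff_eq_sum (s := p.roots.toFinset) (v := id) Function.injective_id.injOn
    (by rw [hcard, degree_eq_natDegree hq]; norm_cast)]
  refine Finset.sum_congr rfl fun x hx => ?_
  have hderiv := eval_nodal_derivative_eval_node_eq (v := id) hx
  rw [hnodal, eval_nodal] at hderiv
  exact congrArg (q.eval x / ·) hderiv

lemma sum_roots_fibrePoly (ha : ∀ k, ‖a k‖ < 1) (hc : ‖c‖ = 1) :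
    ∑ z ∈ (fibrePoly a c).roots.toFinset, (1 + poissonSum a z)⁻¹ = 1 := by
  have hmonic := monic_fibrePoly a c
  have hinterp := sum_roots_eval_div_eval_derivative (q := nodal Finset.univ a) hmonic
    (IsAlgClosed.splits _)
    (nodup_roots_of_eval_derivative_ne_zero hmonic.ne_zero fun _ =>
      eval_derivative_fibrePoly_ne_zero ha hc)
    nodal_ne_zero (by rw [natDegree_fibrePoly, natDegree_nodal, Finset.card_univ])
  rw [nodal_monic.leadingCoeff] at hinterp
  rw [← Complex.ofReal_inj, Complex.ofReal_one, ← hinterp]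
  push_cast
  refine Finset.sum_congr rfl fun z hz => ?_
  rw [Multiset.mem_toFinset, mem_roots hmonic.ne_zero] at hz
  have hz1 := norm_eq_one_of_isRoot_fibrePoly ha hc hz
  rw [eval_derivative_fibrePoly ha hc hz, div_mul_cancel_left₀ (eval_nodal_ne_zero ha hz1.ge)]

lemma exists_isRoot_fibrePoly (ha : ∀ k, ‖a k‖ < 1) (hz : ‖z‖ = 1) :
    ∃ c : ℂ, ‖c‖ = 1 ∧ (fibrePoly a c).IsRoot z := by
  have hD := eval_blaschkeDen_ne_zero ha hz.le
  refine ⟨z * (nodal Finset.univ a).eval z / (blaschkeDen a).eval z, ?_,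
    isRoot_fibrePoly_iff.2 (div_mul_cancel₀ _ hD).symm⟩
  rw [norm_div, norm_mul, hz, one_mul, norm_eval_nodal_eq hz, div_self (norm_ne_zero_iff.2 hD)]

lemma exists_finset_sum_inv_one_add_poissonSum (ha : ∀ k, ‖a k‖ < 1) (hz : ‖z‖ = 1) :
    ∃ s : Finset ℂ, s.card = Fintype.card ι ∧ (∀ w ∈ s, ‖w‖ = 1) ∧
      (1 + poissonSum a z)⁻¹ + ∑ w ∈ s, (1 + poissonSum a w)⁻¹ = 1 := by
  obtain ⟨c, hc, hroot⟩ := exists_isRoot_fibrePoly ha hz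
  have hp := (monic_fibrePoly a c).ne_zero
  have hzs : z ∈ (fibrePoly a c).roots.toFinset := by
    rwa [Multiset.mem_toFinset, mem_roots hp]
  have hnodup := nodup_roots_of_eval_derivative_ne_zero hp fun _ =>
    eval_derivative_fibrePoly_ne_zero ha hc
  refine ⟨(fibrePoly a c).roots.toFinset.erase z, ?_, fun w hw => ?_, ?_⟩
  · rw [Finset.card_erase_of_mem hzs, Multiset.toFinset_card_of_nodup hnodup,
      ← (IsAlgClosed.splits _).natDegree_eq_card_roots, natDegree_fibrePoly, Nat.add_sub_cancel]
  · rw [Finset.mem_erase, Multiset.mem_toFinset, mem_roots hp] at hw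
    exact norm_eq_one_of_isRoot_fibrePoly ha hc hw.2
  · exact (Finset.add_sum_erase _ (fun w => (1 + poissonSum a w)⁻¹) hzs).trans
      (sum_roots_fibrePoly ha hc)

lemma inv_one_add_poissonSum_add_le (ha : ∀ k, ‖a k‖ < 1) {M : ℝ}
    (hM : ∀ w : ℂ, ‖w‖ = 1 → poissonSum a w ≤ M) (hz : ‖z‖ = 1) :
    (1 + poissonSum a z)⁻¹ + Fintype.card ι * (1 + M)⁻¹ ≤ 1 := by
  obtain ⟨s, hcard, hs, hsum⟩ := exists_finset_sum_inv_one_add_poissonSum ha hz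
  have := s.card_nsmul_le_sum (fun w => (1 + poissonSum a w)⁻¹) (1 + M)⁻¹ fun w hw =>
    inv_anti₀ (by linarith [poissonSum_nonneg ha (hs w hw)]) (by linarith [hM w (hs w hw)])
  rw [hcard, nsmul_eq_mul] at this
  linarith

lemma one_le_inv_one_add_poissonSum_add (ha : ∀ k, ‖a k‖ < 1) {m : ℝ} (hm0 : 0 ≤ m)
    (hm : ∀ w : ℂ, ‖w‖ = 1 → m ≤ poissonSum a w) (hz : ‖z‖ = 1) :
    1 ≤ (1 + poissonSum a z)⁻¹ + Fintype.card ι * (1 + m)⁻¹ := by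
  obtain ⟨s, hcard, hs, hsum⟩ := exists_finset_sum_inv_one_add_poissonSum ha hz
  have := s.sum_le_card_nsmul (fun w => (1 + poissonSum a w)⁻¹) (1 + m)⁻¹ fun w hw =>
    inv_anti₀ (by linarith) (by linarith [hm w (hs w hw)])
  rw [hcard, nsmul_eq_mul] at this
  linarith

end Fibre

/-- The supremum of `poissonSum a` over the unit circle: the number `M(B)` in terms of the zeros
of `B`. -/
noncomputable def poissonSup {ι : Type*} [Fintype ι] (a : ι → ℂ) : ℝ :=
  sSup (poissonSum a '' sphere 0 1)

/-- The infimum of `poissonSum a` over the unit circle: the number `m(B)` in terms of the zeros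
of `B`. -/
noncomputable def poissonInf {ι : Type*} [Fintype ι] (a : ι → ℂ) : ℝ :=
  sInf (poissonSum a '' sphere 0 1)

section Extrema

variable {ι : Type*} [Fintype ι] {a : ι → ℂ} {z : ℂ}

lemma continuousOn_poissonSum (ι : Type*) [Fintype ι] :
    ContinuousOn (fun p : (ι → ℂ) × ℂ => poissonSum p.1 p.2) (ball 0 1 ×ˢ sphere 0 1) := by
  refine continuousOn_finsetSum _ fun k _ => ?_
  simp only [poissonKernel_def, sub_zero]
  refine ContinuousOn.div (by fun_prop) (by fun_prop) fun p hp => ?_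
  have ha := (norm_le_pi_norm p.1 k).trans_lt (mem_ball_zero_iff.1 hp.1)
  have hz := mem_sphere_zero_iff_norm.1 hp.2
  exact pow_ne_zero 2 (norm_ne_zero_iff.2 (sub_ne_zero.2
    (ne_of_norm_lt_one_of_one_le_norm ha hz.ge)))

lemma isCompact_image_poissonSum (ha : ∀ k, ‖a k‖ < 1) :
    IsCompact (poissonSum a '' sphere 0 1) := by
  refine (isCompact_sphere 0 1).image_of_continuousOn ?_
  exact (continuousOn_poissonSum ι).comp (f := fun z => (a, z)) (by fun_prop) fun z hz =>
    ⟨mem_ball_zero_iff.2 ((pi_norm_lt_iff one_pos).2 ha), hz⟩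

lemma nonempty_image_poissonSum (a : ι → ℂ) : (poissonSum a '' sphere 0 1).Nonempty :=
  (NormedSpace.sphere_nonempty.2 zero_le_one).image _

lemma isGreatest_poissonSup (ha : ∀ k, ‖a k‖ < 1) :
    IsGreatest (poissonSum a '' sphere 0 1) (poissonSup a) :=
  (isCompact_image_poissonSum ha).isGreatest_sSup (nonempty_image_poissonSum a)

lemma isLeast_poissonInf (ha : ∀ k, ‖a k‖ < 1) :
    IsLeast (poissonSum a '' sphere 0 1) (poissonInf a) :=
  (isCompact_image_poissonSum ha).isLeast_sInf (nonempty_image_poissonSum a)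

lemma poissonSum_le_poissonSup (ha : ∀ k, ‖a k‖ < 1) (hz : ‖z‖ = 1) :
    poissonSum a z ≤ poissonSup a :=
  (isGreatest_poissonSup ha).2 ⟨z, mem_sphere_zero_iff_norm.2 hz, rfl⟩

lemma poissonInf_le_poissonSum (ha : ∀ k, ‖a k‖ < 1) (hz : ‖z‖ = 1) :
    poissonInf a ≤ poissonSum a z :=
  (isLeast_poissonInf ha).2 ⟨z, mem_sphere_zero_iff_norm.2 hz, rfl⟩

lemma exists_poissonSum_eq_poissonSup (ha : ∀ k, ‖a k‖ < 1) :
    ∃ z : ℂ, ‖z‖ = 1 ∧ poissonSum a z = poissonSup a := by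
  obtain ⟨z, hz, h⟩ := (isGreatest_poissonSup ha).1
  exact ⟨z, mem_sphere_zero_iff_norm.1 hz, h⟩

lemma exists_poissonSum_eq_poissonInf (ha : ∀ k, ‖a k‖ < 1) :
    ∃ z : ℂ, ‖z‖ = 1 ∧ poissonSum a z = poissonInf a := by
  obtain ⟨z, hz, h⟩ := (isLeast_poissonInf ha).1
  exact ⟨z, mem_sphere_zero_iff_norm.1 hz, h⟩

lemma poissonInf_nonneg (ha : ∀ k, ‖a k‖ < 1) : 0 ≤ poissonInf a := by
  obtain ⟨z, hz, h⟩ := exists_poissonSum_eq_poissonInf ha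
  exact h ▸ poissonSum_nonneg ha hz

lemma poissonInf_pos [Nonempty ι] (ha : ∀ k, ‖a k‖ < 1) : 0 < poissonInf a := by
  obtain ⟨z, hz, h⟩ := exists_poissonSum_eq_poissonInf ha
  exact h ▸ poissonSum_pos ha hz

lemma poissonSup_nonneg (ha : ∀ k, ‖a k‖ < 1) : 0 ≤ poissonSup a := by
  obtain ⟨z, hz, h⟩ := exists_poissonSum_eq_poissonSup ha
  exact h ▸ poissonSum_nonneg ha hz

lemma card_le_poissonSup (ha : ∀ k, ‖a k‖ < 1) : Fintype.card ι ≤ poissonSup a := by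
  obtain ⟨z, hz, h⟩ := exists_poissonSum_eq_poissonSup ha
  have hle := inv_one_add_poissonSum_add_le ha (fun _ => poissonSum_le_poissonSup ha) hz
  have hpos : 0 < 1 + poissonSup a := by linarith [poissonSup_nonneg ha]
  rw [h] at hle
  field_simp at hle
  linarith

lemma poissonInf_le_card (ha : ∀ k, ‖a k‖ < 1) : poissonInf a ≤ Fintype.card ι := by
  obtain ⟨z, hz, h⟩ := exists_poissonSum_eq_poissonInf ha
  have hle := one_le_inv_one_add_poissonSum_add ha (poissonInf_nonneg ha)
    (fun _ => poissonInf_le_poissonSum ha) hz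
  have hpos : 0 < 1 + poissonInf a := by linarith [poissonInf_nonneg ha]
  rw [h] at hle
  field_simp at hle
  linarith

lemma card_le_poissonInf_mul (ha : ∀ k, ‖a k‖ < 1) :
    Fintype.card ι ≤ poissonInf a * (poissonSup a - Fintype.card ι + 1) := by
  obtain ⟨z, hz, h⟩ := exists_poissonSum_eq_poissonInf ha
  have hle := inv_one_add_poissonSum_add_le ha (fun _ => poissonSum_le_poissonSup ha) hz
  have hpos : 0 < 1 + poissonInf a := by linarith [poissonInf_nonneg ha]
  have hpos' : 0 < 1 + poissonSup a := by linarith [poissonSup_nonneg ha]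
  rw [h] at hle
  field_simp at hle
  linarith

lemma poissonInf_mul_poissonSup_le (ha : ∀ k, ‖a k‖ < 1) :
    poissonInf a * poissonSup a ≤ (Fintype.card ι - 1) * poissonSup a + Fintype.card ι := by
  obtain ⟨z, hz, h⟩ := exists_poissonSum_eq_poissonSup ha
  have hle := one_le_inv_one_add_poissonSum_add ha (poissonInf_nonneg ha)
    (fun _ => poissonInf_le_poissonSum ha) hz
  have hpos : 0 < 1 + poissonInf a := by linarith [poissonInf_nonneg ha]
  have hpos' : 0 < 1 + poissonSup a := by linarith [poissonSup_nonneg ha]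
  rw [h] at hle
  field_simp at hle
  linarith

lemma card_div_le_poissonInf (ha : ∀ k, ‖a k‖ < 1) :
    Fintype.card ι / (poissonSup a - Fintype.card ι + 1) ≤ poissonInf a :=
  (div_le_iff₀ (by linarith [card_le_poissonSup ha])).2 (card_le_poissonInf_mul ha)

lemma poissonInf_le_card_sub_one_add [Nonempty ι] (ha : ∀ k, ‖a k‖ < 1) :
    poissonInf a ≤ Fintype.card ι - 1 + Fintype.card ι / poissonSup a := by
  have hpos : 0 < poissonSup a :=
    (Nat.cast_pos.2 Fintype.card_pos).trans_le (card_le_poissonSup ha)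
  have := poissonInf_mul_poissonSup_le ha
  rw [← sub_le_iff_le_add', le_div_iff₀ hpos]
  linarith

end Extrema

section Derivative

variable {n : ℕ} {α : ℂ} {a : Fin n → ℂ} {z : ℂ}

lemma blaschkeProduct_eq_mul_div (α : ℂ) (a : Fin n → ℂ) :
    blaschkeProduct α a =
      fun z => α * ((nodal Finset.univ a).eval z / (blaschkeDen a).eval z) := by
  ext z
  rw [blaschkeProduct, Finset.prod_div_distrib, eval_nodal, eval_blaschkeDen]

lemma norm_blaschkeProduct (hα : ‖α‖ = 1) (ha : ∀ k, ‖a k‖ < 1) (hz : ‖z‖ = 1) :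
    ‖blaschkeProduct α a z‖ = 1 := by
  have hD := norm_ne_zero_iff.2 (eval_blaschkeDen_ne_zero ha hz.le)
  rw [blaschkeProduct_eq_mul_div, norm_mul, norm_div, norm_eval_nodal_eq hz, div_self hD, hα,
    one_mul]

lemma mul_deriv_blaschkeProduct (ha : ∀ k, ‖a k‖ < 1) (hz : ‖z‖ = 1) :
    z * deriv (blaschkeProduct α a) z = blaschkeProduct α a z * poissonSum a z := by
  have hD := eval_blaschkeDen_ne_zero ha hz.le
  have hderiv := (((nodal Finset.univ a).hasDerivAt z).fun_div
    ((blaschkeDen a).hasDerivAt z) hD).const_mul α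
  rw [blaschkeProduct_eq_mul_div, hderiv.deriv, ofReal_poissonSum ha hz,
    eval_derivative_nodal fun k => ne_of_norm_lt_one_of_one_le_norm (ha k) hz.ge,
    eval_derivative_blaschkeDen fun k => one_sub_conj_mul_ne_zero (ha k) hz.le]
  field_simp
  ring

lemma norm_deriv_blaschkeProduct (hα : ‖α‖ = 1) (ha : ∀ k, ‖a k‖ < 1) (hz : ‖z‖ = 1) :
    ‖deriv (blaschkeProduct α a) z‖ = poissonSum a z := by
  have h := congrArg norm (mul_deriv_blaschkeProduct (α := α) ha hz)
  rwa [norm_mul, norm_mul, hz, norm_blaschkeProduct hα ha hz, one_mul, one_mul, Complex.norm_real,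
    Real.norm_of_nonneg (poissonSum_nonneg ha hz)] at h

lemma image_norm_deriv_blaschkeProduct (hα : ‖α‖ = 1) (ha : ∀ k, ‖a k‖ < 1) :
    (fun z => ‖deriv (blaschkeProduct α a) z‖) '' sphere 0 1 = poissonSum a '' sphere 0 1 :=
  Set.image_congr fun _ hz => norm_deriv_blaschkeProduct hα ha (mem_sphere_zero_iff_norm.1 hz)

lemma supDeriv_blaschkeProduct (hα : ‖α‖ = 1) (ha : ∀ k, ‖a k‖ < 1) :
    supDeriv (blaschkeProduct α a) = poissonSup a := by
  rw [supDeriv, image_norm_deriv_blaschkeProduct hα ha, poissonSup]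

lemma infDeriv_blaschkeProduct (hα : ‖α‖ = 1) (ha : ∀ k, ‖a k‖ < 1) :
    infDeriv (blaschkeProduct α a) = poissonInf a := by
  rw [infDeriv, image_norm_deriv_blaschkeProduct hα ha, poissonInf]

end Derivative

mutual

/-- The un-normalised orthogonal polynomials on the unit circle for the weight `‖1 - z‖ ^ (2 * b)`,
generated by the Szegő recursion. The extremal Blaschke products are built from them. -/
noncomputable def szego (b : ℝ) : ℕ → ℂ[X]
  | 0 => 1
  | d + 1 => C (b + d + 1 : ℂ) * (X * szego b d) + C (b : ℂ) * szegoRev b d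

/-- The reversed polynomial `z ^ d * conj (szego b d (1 / conj z))`, which drives the Szegő
recursion together with `szego b d`. -/
noncomputable def szegoRev (b : ℝ) : ℕ → ℂ[X]
  | 0 => 1
  | d + 1 => C (b + d + 1 : ℂ) * szegoRev b d + C (b : ℂ) * (X * szego b d)

end

/-- The numerator, up to a constant factor, of the Blaschke product of degree `d + 1` that is
extremal in one of the two inequalities between `m(B)` and `M(B)`: in the lower one if `1 ≤ b` and
in the upper one if `b ≤ 1`. -/
noncomputable def extremalPoly (b : ℝ) (d : ℕ) : ℂ[X] :=
  szego b (d + 1) - C (d + 1 : ℂ) * szego b d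

section Extremal

variable {b : ℝ} {d : ℕ} {z : ℂ}

lemma X_mul_derivative_szego_add_szegoRev (b : ℝ) (d : ℕ) :
    X * derivative (szego b d + szegoRev b d) =
        C (b + d : ℂ) * szego b d - C (b : ℂ) * szegoRev b d ∧
      derivative (szegoRev b d) = C (d : ℂ) * szego b d - X * derivative (szego b d) := by
  induction d with
  | zero => simp [szego, szegoRev]
  | succ d ih =>
    obtain ⟨hadd, hrev⟩ := ih
    simp only [szego, szegoRev, derivative_add, derivative_mul, derivative_C, derivative_X,
      derivative_one, C_add, C_1, Nat.cast_add, Nat.cast_one, zero_mul, zero_add,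
      one_mul] at hadd hrev ⊢
    constructor
    · linear_combination (C (b : ℂ) + C (d : ℂ) + 1 + C (b : ℂ)) * X * hrev
    · linear_combination
        ((C (b : ℂ) + C (d : ℂ) + 1) * X) * hrev + C (b : ℂ) * hadd +
          (C (b : ℂ) + C (d : ℂ) + 1) * hrev - (C (b : ℂ) + C (d : ℂ) + 1) * hadd

lemma X_mul_derivative_extremalPoly (b : ℝ) (d : ℕ) :
    X * derivative (extremalPoly b d) =
      C (d + 1 : ℂ) * (extremalPoly b d + C (1 - b : ℂ) * szego b d) := by
  obtain ⟨hadd, hrev⟩ := X_mul_derivative_szego_add_szegoRev b d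
  simp only [extremalPoly, szego, derivative_add, derivative_sub, derivative_mul, derivative_C,
    derivative_X, derivative_one, C_add, C_sub, C_1, zero_mul, zero_add, one_mul] at hadd hrev ⊢
  linear_combination (C (b : ℂ) + (C (d : ℂ) + 1)) * X * hrev - (C (d : ℂ) + 1) * hadd

lemma eval_szego_eq_eval_szegoRev_conj (b : ℝ) (d : ℕ) (hz : ‖z‖ = 1) :
    (szegoRev b d).eval z = z ^ d * conj ((szego b d).eval z) ∧
      (szego b d).eval z = z ^ d * conj ((szegoRev b d).eval z) := by
  induction d with
  | zero => simp [szego, szegoRev]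
  | succ d ih =>
    obtain ⟨hrev, hszego⟩ := ih
    simp only [szego, szegoRev, eval_add, eval_mul, eval_C, eval_X]
    simp only [map_add, map_mul, map_one, map_natCast, Complex.conj_ofReal]
    have hzz := mul_conj_eq_one hz
    constructor
    · linear_combination (b + d + 1) * hrev + b * z * hszego -
        (b + d + 1) * z ^ d * conj ((szego b d).eval z) * hzz
    · linear_combination (b + d + 1) * z * hszego + b * hrev -
        b * z ^ d * conj ((szego b d).eval z) * hzz

lemma norm_sq_ofReal_mul_add_sub_norm_sq (s t : ℝ) (p q : ℂ) :
    ‖s * p + t * q‖ ^ 2 - ‖s * q + t * p‖ ^ 2 = (s ^ 2 - t ^ 2) * (‖p‖ ^ 2 - ‖q‖ ^ 2) := by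
  rw [← Complex.ofReal_inj]
  push_cast
  simp only [← Complex.mul_conj', map_add, map_mul, Complex.conj_ofReal]
  ring

lemma norm_eval_szegoRev_le (hb : 0 < b) (d : ℕ) (hz : 1 ≤ ‖z‖) :
    ‖(szegoRev b d).eval z‖ ≤ ‖(szego b d).eval z‖ ∧ (szego b d).eval z ≠ 0 := by
  induction d with
  | zero => simp [szego, szegoRev]
  | succ d ih =>
    obtain ⟨hle, hne⟩ := ih
    set s : ℝ := b + d + 1 with hs
    have hbs : b < s := by rw [hs]; linarith [d.cast_nonneg (α := ℝ)]
    have hszego : (szego b (d + 1)).eval z =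
        s * (z * (szego b d).eval z) + b * (szegoRev b d).eval z := by simp [szego, hs]
    have hrev : (szegoRev b (d + 1)).eval z =
        s * (szegoRev b d).eval z + b * (z * (szego b d).eval z) := by simp [szegoRev, hs]
    have hle' : ‖(szegoRev b d).eval z‖ ≤ ‖z * (szego b d).eval z‖ := by
      rw [norm_mul]
      exact hle.trans (le_mul_of_one_le_left (norm_nonneg _) hz)
    rw [hszego, hrev]
    constructor
    · refine le_of_sq_le_sq ?_ (norm_nonneg _)
      rw [← sub_nonneg, norm_sq_ofReal_mul_add_sub_norm_sq]
      exact mul_nonneg (by nlinarith) (by nlinarith [norm_nonneg ((szegoRev b d).eval z)])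
    · intro h
      have hnorm := congrArg norm (eq_neg_of_add_eq_zero_left h)
      have hz0 : z ≠ 0 := norm_pos_iff.1 (one_pos.trans_le hz)
      have hpos := norm_pos_iff.2 (mul_ne_zero hz0 hne)
      rw [norm_neg, norm_mul, norm_mul (b : ℂ), Complex.norm_of_nonneg hb.le,
        Complex.norm_of_nonneg (hb.trans hbs).le] at hnorm
      nlinarith

lemma eval_szego_ne_zero (hb : 0 < b) (d : ℕ) (hz : 1 ≤ ‖z‖) : (szego b d).eval z ≠ 0 :=
  (norm_eval_szegoRev_le hb d hz).2

lemma eval_one_szegoRev (hb : 0 < b) (d : ℕ) : (szegoRev b d).eval 1 = (szego b d).eval 1 := by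
  have hb' : (b : ℂ) ≠ 0 := Complex.ofReal_ne_zero.2 hb.ne'
  obtain ⟨hadd, hrev⟩ := X_mul_derivative_szego_add_szegoRev b d
  apply_fun eval 1 at hadd hrev
  simp only [derivative_add, eval_add, eval_sub, eval_mul, eval_C, eval_X] at hadd hrev
  refine mul_left_cancel₀ hb' ?_
  linear_combination hadd - hrev

lemma natDegree_szego (hb : 0 < b) (d : ℕ) :
    (szego b d).natDegree = d ∧ (szegoRev b d).natDegree ≤ d := by
  induction d with
  | zero => simp [szego, szegoRev]
  | succ d ih =>
    obtain ⟨hszego, hrev⟩ := ih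
    have hne : (b + d + 1 : ℂ) ≠ 0 := by exact_mod_cast (by positivity : (b + d + 1 : ℝ) ≠ 0)
    have hne' : szego b d ≠ 0 := fun h => eval_szego_ne_zero hb d (z := 1) (by simp) (by simp [h])
    have hX : (X * szego b d).natDegree = d + 1 := by rw [natDegree_X_mul hne', hszego]
    constructor
    · rw [szego, natDegree_add_eq_left_of_natDegree_lt, natDegree_C_mul hne, hX]
      rw [natDegree_C_mul hne, hX]
      exact Nat.lt_succ_of_le ((natDegree_C_mul_le _ _).trans hrev)
    · rw [szegoRev]
      exact natDegree_add_le_of_degree_le ((natDegree_C_mul_le _ _).trans (by lia))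
        ((natDegree_C_mul_le _ _).trans hX.le)

lemma natDegree_extremalPoly (hb : 0 < b) (d : ℕ) : (extremalPoly b d).natDegree = d + 1 := by
  rw [extremalPoly, natDegree_sub_eq_left_of_natDegree_lt, (natDegree_szego hb (d + 1)).1]
  refine (natDegree_C_mul_le _ _).trans_lt ?_
  rw [(natDegree_szego hb d).1, (natDegree_szego hb (d + 1)).1]
  exact d.lt_succ_self

lemma eval_extremalPoly (b : ℝ) (d : ℕ) (z : ℂ) :
    (extremalPoly b d).eval z =
      ((b + d + 1) * z - (d + 1)) * (szego b d).eval z + b * (szegoRev b d).eval z := by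
  simp only [extremalPoly, szego, eval_sub, eval_add, eval_mul, eval_C, eval_X]
  ring

lemma pow_mul_conj_eval_extremalPoly (b : ℝ) (d : ℕ) (hz : ‖z‖ = 1) :
    z ^ (d + 1) * conj ((extremalPoly b d).eval z) =
      (b + d + 1 - (d + 1) * z) * (szegoRev b d).eval z + b * z * (szego b d).eval z := by
  obtain ⟨hrev, hszego⟩ := eval_szego_eq_eval_szegoRev_conj b d hz
  simp only [eval_extremalPoly, map_add, map_sub, map_mul, map_one, map_natCast,
    Complex.conj_ofReal]
  linear_combination (b + d + 1) * z ^ d * conj ((szego b d).eval z) * mul_conj_eq_one hz -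
    (b + d + 1 - (d + 1) * z) * hrev - b * z * hszego

lemma eval_one_extremalPoly (hb : 0 < b) (d : ℕ) :
    (extremalPoly b d).eval 1 = 2 * b * (szego b d).eval 1 := by
  rw [eval_extremalPoly, eval_one_szegoRev hb]
  ring

lemma norm_le_one_of_isRoot_extremalPoly (hb : 0 < b) (hz : (extremalPoly b d).IsRoot z) :
    ‖z‖ ≤ 1 := by
  by_contra! hlt
  obtain ⟨hle, hne⟩ := norm_eval_szegoRev_le hb d hlt.le
  rw [IsRoot, eval_extremalPoly] at hz
  have hroot : ((b + d + 1 : ℝ) : ℂ) * (z * (szego b d).eval z) =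
      (d + 1 : ℝ) * (szego b d).eval z - (b : ℝ) * (szegoRev b d).eval z := by
    push_cast
    linear_combination hz
  have hnorm := (congrArg norm hroot).le.trans (norm_sub_le _ _)
  rw [norm_mul, norm_mul, norm_mul, norm_mul, Complex.norm_of_nonneg (by positivity),
    Complex.norm_of_nonneg (by positivity), Complex.norm_of_nonneg hb.le] at hnorm
  have hpos := mul_pos (sub_pos.2 hlt) (norm_pos_iff.2 hne)
  have hbd : 0 < b + d + 1 := by positivity
  nlinarith [mul_pos hbd hpos, mul_le_mul_of_nonneg_left hle hb.le]

lemma eval_extremalPoly_ne_zero (hb : 0 < b) (d : ℕ) (hz : ‖z‖ = 1) :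
    (extremalPoly b d).eval z ≠ 0 := by
  intro hroot
  have hszego := eval_szego_ne_zero hb d hz.ge
  have hconj := pow_mul_conj_eval_extremalPoly b d hz
  rw [hroot, map_zero, mul_zero] at hconj
  rw [eval_extremalPoly] at hroot
  have hdet : (((d + 1) * (b + d + 1) : ℝ) : ℂ) * (szego b d).eval z * (z - 1) ^ 2 = 0 := by
    push_cast
    linear_combination -(b + d + 1 - (d + 1) * z) * hroot - b * hconj
  have hpos : (((d + 1) * (b + d + 1) : ℝ) : ℂ) ≠ 0 :=
    Complex.ofReal_ne_zero.2 (by positivity)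
  have hz1 : z = 1 := sub_eq_zero.1 (eq_zero_of_pow_eq_zero
    ((mul_eq_zero.1 hdet).resolve_left (mul_ne_zero hpos hszego)))
  rw [← eval_extremalPoly, hz1, eval_one_extremalPoly hb, ← hz1] at hroot
  exact mul_ne_zero (mul_ne_zero two_ne_zero (Complex.ofReal_ne_zero.2 hb.ne')) hszego hroot

lemma norm_lt_one_of_isRoot_extremalPoly (hb : 0 < b) (hz : (extremalPoly b d).IsRoot z) :
    ‖z‖ < 1 :=
  (norm_le_one_of_isRoot_extremalPoly hb hz).lt_of_ne fun h => eval_extremalPoly_ne_zero hb d h hz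

lemma two_mul_re_szego_div_extremalPoly (hb : 0 < b) (d : ℕ) (hz : ‖z‖ = 1) :
    2 * (d + 1) * ((szego b d).eval z / (extremalPoly b d).eval z).re =
      b * (b + d + 1) * ‖z * (szego b d).eval z + (szegoRev b d).eval z‖ ^ 2 /
        ‖(extremalPoly b d).eval z‖ ^ 2 - 1 := by
  have hp := eval_extremalPoly b d z
  have hp_ne := eval_extremalPoly_ne_zero hb d hz
  have hp_ne' : conj ((extremalPoly b d).eval z) ≠ 0 := (_root_.map_ne_zero _).2 hp_ne
  have hp_conj := pow_mul_conj_eval_extremalPoly b d hz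
  obtain ⟨hrev, hszego⟩ := eval_szego_eq_eval_szegoRev_conj b d hz
  set x := (szego b d).eval z
  set y := (szegoRev b d).eval z
  set p := (extremalPoly b d).eval z
  have hx_conj : z ^ (d + 1) * conj x = z * y := by linear_combination -z * hrev
  set q := z * x + y with hq
  have hq_conj : z ^ (d + 1) * conj q = q := by
    rw [hq, map_add, map_mul]
    linear_combination z ^ d * conj x * mul_conj_eq_one hz - hrev - z * hszego
  have hz_pow : z ^ (d + 1) ≠ 0 := pow_ne_zero _ (norm_ne_zero_iff.1 (hz ▸ one_ne_zero))
  rw [← Complex.ofReal_inj]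
  push_cast
  rw [Complex.re_eq_add_conj, ← Complex.mul_conj', ← Complex.mul_conj', map_div₀]
  field_simp
  refine mul_left_cancel₀ hz_pow ?_
  linear_combination ((d + 1) * x + p) * hp_conj + (d + 1) * p * hx_conj -
    b * (b + d + 1) * q * hq_conj - b * (b + d + 1) * (q + z * x + y) * hq +
    ((b + d + 1 - (d + 1) * z) * y + b * z * x + (d + 1) * z * y) * hp

lemma exists_eq_C_mul_nodal {K : Type*} [Field K] {p : K[X]} {n : ℕ} (hp : p.Splits)
    (hn : p.natDegree = n) : ∃ a : Fin n → K, p = C p.leadingCoeff * nodal Finset.univ a := by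
  have hlen : p.roots.toList.length = n := by
    rw [Multiset.length_toList, ← hp.natDegree_eq_card_roots, hn]
  subst hlen
  refine ⟨p.roots.toList.get, hp.eq_prod_roots.trans ?_⟩
  simp only [nodal_eq, List.get_eq_getElem]
  rw [Fin.prod_univ_fun_getElem p.roots.toList fun x => X - C x, ← Multiset.prod_coe,
    ← Multiset.map_coe, Multiset.coe_toList]

lemma exists_poissonSum_eq (hb : 0 < b) (d : ℕ) :
    ∃ a : Fin (d + 1) → ℂ, (∀ k, ‖a k‖ < 1) ∧ ∀ z : ℂ, ‖z‖ = 1 →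
      poissonSum a z = d + b + b * (1 - b) * (b + d + 1) *
        (‖z * (szego b d).eval z + (szegoRev b d).eval z‖ ^ 2 /
          ‖(extremalPoly b d).eval z‖ ^ 2) := by
  obtain ⟨a, ha⟩ := exists_eq_C_mul_nodal (IsAlgClosed.splits _) (natDegree_extremalPoly hb d)
  have ha_norm k : ‖a k‖ < 1 := by
    refine norm_lt_one_of_isRoot_extremalPoly hb (d := d) ?_
    rw [ha, IsRoot, eval_mul, eval_nodal_at_node (Finset.mem_univ k), mul_zero]
  refine ⟨a, ha_norm, fun z hz => ?_⟩
  have hA := eval_extremalPoly_ne_zero hb d hz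
  have hlog : z * (nodal Finset.univ a).derivative.eval z / (nodal Finset.univ a).eval z =
      (d + 1 : ℝ) + ((d + 1) * (1 - b) : ℝ) *
        ((szego b d).eval z / (extremalPoly b d).eval z) := by
    have hderiv := congrArg (eval z) (X_mul_derivative_extremalPoly b d)
    rw [ha, derivative_C_mul, ← ha] at hderiv
    simp only [eval_mul, eval_add, eval_X, eval_C] at hderiv
    have hA' := congrArg (eval z) ha
    rw [eval_mul, eval_C] at hA'
    have hN : (nodal Finset.univ a).eval z ≠ 0 := eval_nodal_ne_zero ha_norm hz.ge
    push_cast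
    field_simp
    linear_combination (nodal Finset.univ a).eval z * hderiv +
      z * (nodal Finset.univ a).derivative.eval z * hA'
  rw [poissonSum_eq_two_mul_re_sub_card fun k =>
    ne_of_norm_lt_one_of_one_le_norm (ha_norm k) hz.ge, hlog, Complex.add_re, Complex.ofReal_re,
    Complex.re_ofReal_mul, Fintype.card_fin]
  push_cast
  linear_combination (1 - b) * two_mul_re_szego_div_extremalPoly hb d hz

lemma norm_sq_div_norm_sq_eval_one_extremalPoly (hb : 0 < b) (d : ℕ) :
    ‖1 * (szego b d).eval 1 + (szegoRev b d).eval 1‖ ^ 2 / ‖(extremalPoly b d).eval 1‖ ^ 2 =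
      1 / b ^ 2 := by
  have hx : ‖(szego b d).eval 1‖ ≠ 0 := norm_ne_zero_iff.2 (eval_szego_ne_zero hb d (by simp))
  rw [eval_one_extremalPoly hb, eval_one_szegoRev hb, one_mul, ← two_mul, norm_mul, norm_mul,
    norm_mul, Complex.norm_of_nonneg hb.le]
  have := hb.ne'
  field_simp

lemma exists_poissonSum_one_eq (hb : 0 < b) (d : ℕ) :
    ∃ a : Fin (d + 1) → ℂ, (∀ k, ‖a k‖ < 1) ∧ poissonSum a 1 = (d + 1) / b ∧
      ∀ z : ℂ, ‖z‖ = 1 → ∃ t : ℝ, 0 ≤ t ∧ poissonSum a z = d + b + (1 - b) * t := by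
  obtain ⟨a, ha, hP⟩ := exists_poissonSum_eq hb d
  refine ⟨a, ha, ?_, fun z hz => ⟨b * (b + d + 1) * (‖z * (szego b d).eval z +
    (szegoRev b d).eval z‖ ^ 2 / ‖(extremalPoly b d).eval z‖ ^ 2), by positivity,
    (hP z hz).trans (by ring)⟩⟩
  rw [hP 1 norm_one, norm_sq_div_norm_sq_eval_one_extremalPoly hb]
  have := hb.ne'
  field_simp
  ring

lemma exists_poissonSup_eq_add (hb : 1 ≤ b) (d : ℕ) :
    ∃ a : Fin (d + 1) → ℂ, (∀ k, ‖a k‖ < 1) ∧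
      poissonSup a = d + b ∧ poissonInf a = (d + 1) / b := by
  have hb0 := zero_lt_one.trans_le hb
  obtain ⟨a, ha, hone, hP⟩ := exists_poissonSum_one_eq hb0 d
  have hSup_le : poissonSup a ≤ d + b := by
    obtain ⟨z, hz, h⟩ := exists_poissonSum_eq_poissonSup ha
    obtain ⟨t, ht, hPz⟩ := hP z hz
    nlinarith
  have hInf_le : poissonInf a ≤ (d + 1) / b := hone ▸ poissonInf_le_poissonSum ha norm_one
  have hlower := card_le_poissonInf_mul ha
  have hInf_pos := poissonInf_pos ha
  rw [le_div_iff₀ hb0] at hInf_le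
  push_cast [Fintype.card_fin] at hlower
  have hSup : poissonSup a = d + b := hSup_le.antisymm (by nlinarith)
  refine ⟨a, ha, hSup, (eq_div_iff hb0.ne').2 (hInf_le.antisymm ?_)⟩
  rw [hSup] at hlower
  linarith

lemma exists_poissonInf_eq_add (hb : 0 < b) (hb1 : b ≤ 1) (d : ℕ) :
    ∃ a : Fin (d + 1) → ℂ, (∀ k, ‖a k‖ < 1) ∧
      poissonSup a = (d + 1) / b ∧ poissonInf a = d + b := by
  obtain ⟨a, ha, hone, hP⟩ := exists_poissonSum_one_eq hb d
  have hle_Inf : d + b ≤ poissonInf a := by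
    obtain ⟨z, hz, h⟩ := exists_poissonSum_eq_poissonInf ha
    obtain ⟨t, ht, hPz⟩ := hP z hz
    nlinarith
  have hle_Sup : (d + 1) / b ≤ poissonSup a := hone ▸ poissonSum_le_poissonSup ha norm_one
  have hupper := poissonInf_mul_poissonSup_le ha
  have hSup_pos := (div_pos (by positivity) hb).trans_le hle_Sup
  rw [div_le_iff₀ hb] at hle_Sup
  push_cast [Fintype.card_fin] at hupper
  have hInf : poissonInf a = d + b := le_antisymm (by nlinarith) hle_Inf
  refine ⟨a, ha, (eq_div_iff hb.ne').2 (le_antisymm ?_ hle_Sup), hInf⟩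
  rw [hInf] at hupper
  linarith

end Extremal

section Continuity

lemma continuousOn_sSup_image {X Y : Type*} [TopologicalSpace X] [TopologicalSpace Y]
    {α : Type*} [ConditionallyCompleteLinearOrder α] [TopologicalSpace α] [OrderTopology α]
    {f : X → Y → α} {s : Set X} {K : Set Y} (hK : IsCompact K)
    (hf : ContinuousOn (fun p : X × Y => f p.1 p.2) (s ×ˢ K)) :
    ContinuousOn (fun x => sSup (f x '' K)) s := by
  have := isCompact_iff_compactSpace.1 hK
  have hcont : Continuous fun p : s × K => f p.1 p.2 :=
    hf.comp_continuous (f := fun p : s × K => ((p.1 : X), (p.2 : Y))) (by fun_prop)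
      fun p => ⟨p.1.2, p.2.2⟩
  rw [continuousOn_iff_continuous_domRestrict]
  refine (isCompact_univ.continuous_sSup (f := fun (x : s) (y : K) => f x y) hcont).congr
    fun x => ?_
  rw [Set.image_univ, Set.domRestrict_apply, Set.image_eq_range]

variable {ι : Type*} [Fintype ι]

lemma continuousOn_poissonSup : ContinuousOn (poissonSup (ι := ι)) (ball 0 1) :=
  continuousOn_sSup_image (isCompact_sphere 0 1) (continuousOn_poissonSum ι)

lemma continuousOn_poissonInf : ContinuousOn (poissonInf (ι := ι)) (ball 0 1) :=
  continuousOn_sSup_image (α := ℝᵒᵈ) (isCompact_sphere 0 1) (continuousOn_poissonSum ι)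

end Continuity

/-- The holomorphic function of `w` whose real part is `poissonSum (w • a) 1`, a sum of
Herglotz–Riesz kernels. -/
noncomputable def herglotzSum {ι : Type*} [Fintype ι] (a : ι → ℂ) (w : ℂ) : ℂ :=
  ∑ k, herglotzRieszKernel 0 (w * a k) 1

section Dilation

variable {ι : Type*} [Fintype ι] {a : ι → ℂ} {w z : ℂ}

lemma mem_ball_zero_one_iff : a ∈ ball (0 : ι → ℂ) 1 ↔ ∀ k, ‖a k‖ < 1 := by
  rw [mem_ball_zero_iff, pi_norm_lt_iff one_pos]

lemma re_herglotzSum (a : ι → ℂ) (w : ℂ) : (herglotzSum a w).re = poissonSum (w • a) 1 := by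
  simp [herglotzSum, poissonSum, poissonKernel_eq_re_herglotzRieszKernel]

lemma poissonSum_eq_conj_smul_one (a : ι → ℂ) (hz : ‖z‖ = 1) :
    poissonSum a z = poissonSum (conj z • a) 1 := by
  refine Finset.sum_congr rfl fun k _ => ?_
  have hsub : 1 - conj z * a k = conj z * (z - a k) := by
    linear_combination -mul_conj_eq_one hz
  simp only [poissonKernel_def, sub_zero, Pi.smul_apply, smul_eq_mul]
  rw [hsub, norm_mul, norm_mul, Complex.norm_conj, hz]
  simp

lemma poissonSum_zero (hz : ‖z‖ = 1) : poissonSum (0 : ι → ℂ) z = Fintype.card ι := by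
  simp [poissonSum, poissonKernel_def, hz]

lemma poissonSup_zero : poissonSup (0 : ι → ℂ) = Fintype.card ι := by
  obtain ⟨z, hz, h⟩ := exists_poissonSum_eq_poissonSup (a := (0 : ι → ℂ)) (by simp)
  rw [← h, poissonSum_zero hz]

lemma poissonInf_zero : poissonInf (0 : ι → ℂ) = Fintype.card ι := by
  obtain ⟨z, hz, h⟩ := exists_poissonSum_eq_poissonInf (a := (0 : ι → ℂ)) (by simp)
  rw [← h, poissonSum_zero hz]

lemma differentiableOn_exp_herglotzSum (ha : ∀ k, ‖a k‖ < 1) :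
    DifferentiableOn ℂ (fun w => Complex.exp (herglotzSum a w)) (closedBall 0 1) := by
  simp only [herglotzSum, herglotzRieszKernel_def, sub_zero]
  refine DifferentiableOn.cexp (DifferentiableOn.fun_sum fun k _ => DifferentiableOn.div
    (by fun_prop) (by fun_prop) fun w hw => ?_)
  simpa [mul_comm] using one_sub_conj_mul_ne_zero (a := conj (a k)) (by simpa using ha k)
    (mem_closedBall_zero_iff.1 hw)

-- The strict maximum principle for the real part of `herglotzSum a`, via the modulus of its
-- exponential; the value at `0` is `card ι`, so the function cannot be constant.
lemma poissonSum_smul_one_lt_poissonSup (ha : ∀ k, ‖a k‖ < 1) (hw : ‖w‖ < 1)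
    (hcard : Fintype.card ι < poissonSum (w • a) 1) : poissonSum (w • a) 1 < poissonSup a := by
  by_contra! hle
  have hdiff := differentiableOn_exp_herglotzSum ha
  have hmax : IsMaxOn (norm ∘ fun v => Complex.exp (herglotzSum a v)) (ball 0 1) w := by
    refine fun v hv => Complex.norm_le_of_forall_mem_frontier_norm_le isBounded_ball
      (hdiff.mono closure_ball_subset_closedBall).diffContOnCl (fun u hu => ?_) (subset_closure hv)
    rw [frontier_ball _ one_ne_zero, mem_sphere_zero_iff_norm, ← Complex.norm_conj] at hu
    rw [Function.comp_apply, Complex.norm_exp, Complex.norm_exp, Real.exp_le_exp, re_herglotzSum,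
      re_herglotzSum, ← Complex.conj_conj u, ← poissonSum_eq_conj_smul_one a hu]
    exact (poissonSum_le_poissonSup ha hu).trans hle
  have hconst := Complex.norm_eqOn_of_isPreconnected_of_isMaxOn
    (convex_ball (0 : ℂ) 1).isPreconnected isOpen_ball (hdiff.mono ball_subset_closedBall)
    (mem_ball_zero_iff.2 hw) hmax (mem_ball_self one_pos)
  simp only [Function.comp_apply, Function.const_apply, Complex.norm_exp, Real.exp_eq_exp,
    re_herglotzSum, zero_smul, poissonSum_zero norm_one] at hconst
  exact hcard.ne hconst

lemma poissonSup_smul_lt (ha : ∀ k, ‖a k‖ < 1) {r : ℝ} (hr0 : 0 ≤ r) (hr1 : r < 1)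
    (hcard : Fintype.card ι < poissonSup (r • a)) : poissonSup (r • a) < poissonSup a := by
  have hra k : ‖(r • a) k‖ < 1 := by
    rw [Pi.smul_apply, norm_smul, Real.norm_of_nonneg hr0]
    exact mul_lt_one_of_nonneg_of_lt_one_left hr0 hr1 (ha k).le
  obtain ⟨z, hz, h⟩ := exists_poissonSum_eq_poissonSup hra
  rw [poissonSum_eq_conj_smul_one _ hz, ← Complex.coe_smul, smul_smul,
    Complex.coe_smul] at h
  rw [← h] at hcard ⊢
  refine poissonSum_smul_one_lt_poissonSup ha ?_ hcard
  rwa [norm_mul, Complex.norm_conj, hz, one_mul, Complex.norm_of_nonneg hr0]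

lemma one_add_norm_apply_div_le_poissonSup (ha : ∀ k, ‖a k‖ < 1) (k : ι) :
    (1 + ‖a k‖) / (1 - ‖a k‖) ≤ poissonSup a := by
  obtain ⟨z, hz, hzk⟩ := Complex.exists_norm_mul_eq_self (a k)
  have hpos : 0 < 1 - ‖a k‖ := sub_pos.2 (ha k)
  have hsub : z - a k = z * (1 - ‖a k‖ : ℝ) := by
    push_cast
    linear_combination hzk
  calc (1 + ‖a k‖) / (1 - ‖a k‖) = poissonKernel 0 (a k) z := by
        rw [poissonKernel_def, sub_zero, sub_zero, hsub, norm_mul, hz,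
          Complex.norm_of_nonneg hpos.le]
        field_simp
        ring
    _ ≤ poissonSum a z := Finset.single_le_sum (f := fun k => poissonKernel 0 (a k) z)
        (fun j _ => (poissonKernel_zero_pos (ha j) hz).le) (Finset.mem_univ k)
    _ ≤ poissonSup a := poissonSum_le_poissonSup ha hz

lemma norm_le_poissonSup_sub_one_div [Nonempty ι] (ha : ∀ k, ‖a k‖ < 1) :
    ‖a‖ ≤ (poissonSup a - 1) / (poissonSup a + 1) := by
  have hpos : 0 < poissonSup a + 1 := by linarith [poissonSup_nonneg ha]
  refine (pi_norm_le_iff_of_nonempty a).2 fun k => (le_div_iff₀ hpos).2 ?_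
  have := one_add_norm_apply_div_le_poissonSup ha k
  rw [div_le_iff₀ (sub_pos.2 (ha k))] at this
  linarith

lemma exists_poissonSup_smul_eq [Nonempty ι] {e : ι → ℂ} (he : ‖e‖ = 1) {M : ℝ}
    (hM : Fintype.card ι ≤ M) : ∃ r : ℝ, 0 ≤ r ∧ r < 1 ∧ poissonSup (r • e) = M := by
  have hM0 : 0 ≤ M := (Nat.cast_nonneg _).trans hM
  have hball {r : ℝ} (hr0 : 0 ≤ r) (hr1 : r < 1) : r • e ∈ ball (0 : ι → ℂ) 1 := by
    rwa [mem_ball_zero_iff, norm_smul, he, mul_one, Real.norm_of_nonneg hr0]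
  set s : ℝ := M / (M + 1) with hs
  have hs0 : 0 ≤ s := by positivity
  have hs1 : s < 1 := (div_lt_one (by linarith)).2 (by linarith)
  have hle : M ≤ poissonSup (s • e) := by
    have hse := mem_ball_zero_one_iff.1 (hball hs0 hs1)
    have hnorm := norm_le_poissonSup_sub_one_div hse
    rw [norm_smul, he, mul_one, Real.norm_of_nonneg hs0, hs, ← hs,
      div_le_div_iff₀ (by linarith) (by linarith [poissonSup_nonneg hse])] at hnorm
    linarith
  have hcont : ContinuousOn (fun r : ℝ => poissonSup (r • e)) (Set.Icc 0 s) :=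
    continuousOn_poissonSup.comp (f := fun r : ℝ => r • e) (by fun_prop)
      fun r hr => hball hr.1 (hr.2.trans_lt hs1)
  obtain ⟨r, hr, h⟩ := intermediate_value_Icc hs0 hcont
    ⟨by simpa only [zero_smul, poissonSup_zero] using hM, hle⟩
  exact ⟨r, hr.1, hr.2.trans_lt hs1, h⟩

end Dilation

/-- The set of zero systems, in the open unit polydisc, of the Blaschke products `B` with
`M(B) = M`. -/
def poissonSupLevel (ι : Type*) [Fintype ι] (M : ℝ) : Set (ι → ℂ) :=
  {a | (∀ k, ‖a k‖ < 1) ∧ poissonSup a = M}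

section Level

variable {ι : Type*} [Fintype ι] {M : ℝ}

lemma isCompact_poissonSupLevel [Nonempty ι] (hM : 0 ≤ M) :
    IsCompact (poissonSupLevel ι M) := by
  have hsub : closedBall (0 : ι → ℂ) ((M - 1) / (M + 1)) ⊆ ball 0 1 :=
    closedBall_subset_ball ((div_lt_one (by linarith)).2 (by linarith))
  have heq : poissonSupLevel ι M =
      closedBall 0 ((M - 1) / (M + 1)) ∩ poissonSup ⁻¹' {M} := by
    ext a
    refine ⟨fun ⟨ha, haM⟩ => ⟨?_, haM⟩, fun ⟨ha, haM⟩ => ⟨mem_ball_zero_one_iff.1 (hsub ha), haM⟩⟩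
    rw [mem_closedBall_zero_iff, ← haM]
    exact norm_le_poissonSup_sub_one_div ha
  rw [heq]
  exact (isCompact_closedBall _ _).of_isClosed_subset
    ((continuousOn_poissonSup.mono hsub).preimage_isClosed_of_isClosed isClosed_closedBall
      isClosed_singleton) Set.inter_subset_left

lemma ne_zero_of_mem_poissonSupLevel (hM : Fintype.card ι < M) {a : ι → ℂ}
    (ha : a ∈ poissonSupLevel ι M) : a ≠ 0 := by
  rintro rfl
  exact hM.ne (poissonSup_zero.symm.trans ha.2)

lemma norm_le_norm_of_direction_eq (hM : Fintype.card ι < M) {a b : ι → ℂ}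
    (ha : a ∈ poissonSupLevel ι M) (hb : b ∈ poissonSupLevel ι M)
    (hab : ‖a‖⁻¹ • a = ‖b‖⁻¹ • b) : ‖b‖ ≤ ‖a‖ := by
  by_contra! hlt
  have ha0 := norm_ne_zero_iff.2 (ne_zero_of_mem_poissonSupLevel hM ha)
  have hb0 := norm_pos_iff.2 (ne_zero_of_mem_poissonSupLevel hM hb)
  have hsmul : (‖a‖ / ‖b‖) • b = a := by
    rw [div_eq_mul_inv, ← smul_smul, ← hab, smul_inv_smul₀ ha0]
  have := poissonSup_smul_lt hb.1 (by positivity) ((div_lt_one hb0).2 hlt)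
    (by rwa [hsmul, ha.2])
  rw [hsmul, ha.2, hb.2] at this
  exact this.false

lemma injective_direction_poissonSupLevel (hM : Fintype.card ι < M) :
    Function.Injective fun a : poissonSupLevel ι M => ‖(a : ι → ℂ)‖⁻¹ • (a : ι → ℂ) := by
  intro a b hab
  have hnorm : ‖(a : ι → ℂ)‖ = ‖(b : ι → ℂ)‖ :=
    (norm_le_norm_of_direction_eq hM b.2 a.2 hab.symm).antisymm
      (norm_le_norm_of_direction_eq hM a.2 b.2 hab)
  have hb0 := norm_ne_zero_iff.2 (ne_zero_of_mem_poissonSupLevel hM b.2)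
  simp only [hnorm] at hab
  exact Subtype.ext (smul_right_injective _ (inv_ne_zero hb0) hab)

lemma sphere_subset_range_direction_poissonSupLevel [Nonempty ι] (hM : Fintype.card ι < M) :
    sphere (0 : ι → ℂ) 1 ⊆
      Set.range fun a : poissonSupLevel ι M => ‖(a : ι → ℂ)‖⁻¹ • (a : ι → ℂ) := by
  intro e he
  rw [mem_sphere_zero_iff_norm] at he
  obtain ⟨r, hr0, hr1, hr⟩ := exists_poissonSup_smul_eq he hM.le
  have hnorm : ‖r • e‖ = r := by rw [norm_smul, he, mul_one, Real.norm_of_nonneg hr0]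
  have hmem : r • e ∈ poissonSupLevel ι M :=
    ⟨mem_ball_zero_one_iff.1 (mem_ball_zero_iff.2 (hnorm.trans_lt hr1)), hr⟩
  have hne := norm_ne_zero_iff.2 (ne_zero_of_mem_poissonSupLevel hM hmem)
  refine ⟨⟨r • e, hmem⟩, ?_⟩
  simp only [hnorm] at hne ⊢
  exact inv_smul_smul₀ hne e

lemma one_lt_rank_pi_complex (ι : Type*) [Finite ι] [Nonempty ι] :
    1 < Module.rank ℝ (ι → ℂ) := by
  cases nonempty_fintype ι
  rw [← Module.finrank_eq_rank, Module.finrank_pi_fintype]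
  simp only [Complex.finrank_real_complex, Finset.sum_const, Finset.card_univ, smul_eq_mul]
  exact_mod_cast (by linarith [Fintype.card_pos (α := ι)] : 1 < Fintype.card ι * 2)

-- The radial projection to the unit sphere is a homeomorphism: `poissonSup` increases along rays
-- above the value `card ι`.
lemma isPreconnected_poissonSupLevel [Nonempty ι] (hM : Fintype.card ι < M) :
    IsPreconnected (poissonSupLevel ι M) := by
  have := isCompact_iff_compactSpace.1 (isCompact_poissonSupLevel (ι := ι)
    (hM.le.trans' (Nat.cast_nonneg _)))
  have hne (a : poissonSupLevel ι M) : ‖(a : ι → ℂ)‖ ≠ 0 :=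
    norm_ne_zero_iff.2 (ne_zero_of_mem_poissonSupLevel hM a.2)
  have hcont : Continuous fun a : poissonSupLevel ι M => ‖(a : ι → ℂ)‖⁻¹ • (a : ι → ℂ) := by
    fun_prop (disch := exact hne _)
  have hpre := (isPreconnected_sphere (one_lt_rank_pi_complex ι) 0 1).preimage_of_isClosedMap
    (injective_direction_poissonSupLevel hM) hcont.isClosedMap
    (sphere_subset_range_direction_poissonSupLevel hM)
  rw [isPreconnected_iff_preconnectedSpace, preconnectedSpace_iff_univ]
  convert hpre
  refine (Set.eq_univ_of_forall fun a => ?_).symm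
  rw [Set.mem_preimage, mem_sphere_zero_iff_norm, norm_smul, norm_inv, norm_norm,
    inv_mul_cancel₀ (hne a)]

lemma exists_mem_poissonSupLevel_poissonInf_eq [Nonempty ι] (hM : Fintype.card ι < M) {m : ℝ}
    {a b : ι → ℂ} (ha : a ∈ poissonSupLevel ι M) (hb : b ∈ poissonSupLevel ι M)
    (hm : m ∈ Set.Icc (poissonInf a) (poissonInf b)) :
    ∃ c ∈ poissonSupLevel ι M, poissonInf c = m :=
  (isPreconnected_poissonSupLevel hM).intermediate_value ha hb
    (continuousOn_poissonInf.mono fun _ hc => mem_ball_zero_one_iff.2 hc.1) hm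

lemma exists_poissonSup_eq_poissonInf_eq {n : ℕ} (hn : 1 ≤ n) {m : ℝ} (hmn : m ≤ n) (hnM : n ≤ M)
    (hlower : n / (M - n + 1) ≤ m) (hupper : m ≤ n - 1 + n / M) :
    ∃ a : Fin n → ℂ, (∀ k, ‖a k‖ < 1) ∧ poissonSup a = M ∧ poissonInf a = m := by
  rcases hnM.eq_or_lt with rfl | hlt
  · have hm : m = n := hmn.antisymm (by simpa using hlower)
    exact ⟨0, by simp, by simp [poissonSup_zero], by simp [poissonInf_zero, hm]⟩
  obtain ⟨d, rfl⟩ := Nat.exists_eq_add_of_le' hn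
  push_cast at hlt hlower hupper
  have hM : 0 < M := lt_trans (by positivity) hlt
  have hdM : (d + 1 : ℝ) / ((d + 1) / M) = M := div_div_cancel₀ (by positivity)
  obtain ⟨a, ha, hSupa, hInfa⟩ := exists_poissonSup_eq_add (b := M - d) (by linarith) d
  obtain ⟨b, hb, hSupb, hInfb⟩ := exists_poissonInf_eq_add (b := (d + 1) / M) (by positivity)
    ((div_le_one hM).2 hlt.le) d
  obtain ⟨c, ⟨hc, hSup⟩, hInf⟩ := exists_mem_poissonSupLevel_poissonInf_eq (m := m)
    (by simpa using hlt) ⟨ha, hSupa.trans (add_sub_cancel _ _)⟩ ⟨hb, hSupb.trans hdM⟩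
    ⟨by rwa [hInfa, ← sub_add_cancel (M - d) 1, sub_sub], by linarith⟩
  exact ⟨c, hc, hSup, hInf⟩

end Level

theorem theorem1 (n : ℕ) (hn : 1 ≤ n) :
    (∀ B : ℂ → ℂ, IsBlaschkeProduct n B →
      ((n : ℝ) / (supDeriv B - n + 1) ≤ infDeriv B ∧
        infDeriv B ≤ (n : ℝ) - 1 + n / supDeriv B) ∧
      (0 < infDeriv B ∧ infDeriv B ≤ n ∧ (n : ℝ) ≤ supDeriv B)) ∧
    (∀ m M : ℝ, 0 < m → 0 < M →
      ((n : ℝ) / (M - n + 1) ≤ m ∧ m ≤ (n : ℝ) - 1 + n / M) →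
      (0 < m ∧ m ≤ n ∧ (n : ℝ) ≤ M) →
      ∃ B : ℂ → ℂ, IsBlaschkeProduct n B ∧ supDeriv B = M ∧ infDeriv B = m) := by
  constructor
  · rintro _ ⟨α, a, hα, ha, rfl⟩
    have : Nonempty (Fin n) := Fin.pos_iff_nonempty.1 hn
    have hcard : (Fintype.card (Fin n) : ℝ) = n := congrArg Nat.cast (Fintype.card_fin n)
    rw [supDeriv_blaschkeProduct hα ha, infDeriv_blaschkeProduct hα ha, ← hcard]
    exact ⟨⟨card_div_le_poissonInf ha, poissonInf_le_card_sub_one_add ha⟩,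
      poissonInf_pos ha, poissonInf_le_card ha, card_le_poissonSup ha⟩
  · rintro m M - - ⟨hlower, hupper⟩ ⟨-, hmn, hnM⟩
    obtain ⟨a, ha, hSup, hInf⟩ := exists_poissonSup_eq_poissonInf_eq hn hmn hnM hlower hupper
    exact ⟨blaschkeProduct 1 a, ⟨1, a, norm_one, ha, rfl⟩,
      (supDeriv_blaschkeProduct norm_one ha).trans hSup,
      (infDeriv_blaschkeProduct norm_one ha).trans hInf⟩
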